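/- Let $k$ be a field and let $\mathcal T$ be a Hom-finite Krull-Schmidt triangulated $k$-category with suspension functor $\Sigma$. Let $T$ be an object of $\mathcal T$, put $\Gamma=\operatorname{End}_{\mathcal T}(T)^{\mathrm{op}}$, and let $\operatorname{mod}\Gamma$ be the category of finitely generated left $\Gamma$-modules. Assume that $\operatorname{Hom}_{\mathcal T}(T,-)\colon\mathcal T\to\operatorname{mod}\Gamma$ is a quotient functor, that is, full and dense. Call an object $X$ $T$-supported if $\operatorname{Hom}_{\mathcal T}(T,X)\neq 0$, and let $\operatorname{add}T$ denote the class of direct summands of finite direct sums of copies of $T$. Let $$\tau X\xrightarrow{\;f\;}Y\xrightarrow{\;g\;}X\xrightarrow{\;h\;}\Sigma\tau X$$ be an AR-triangle in $\mathcal T$, i.e. a distinguished triangle with $X$ and $\tau X$ indecomposable and $h\neq 0$ such that every morphism $W\to X$ that is not a split epimorphism factors through $g$. Assume that $X$ and $\tau X$ are both $T$-supported. 1. If $X\notin\operatorname{add}T$ and $\Sigma^{-1}X\notin\operatorname{add}T$, then $\operatorname{Hom}_{\mathcal T}(T,-)$ takes the AR-triangle to an AR-sequence in $\operatorname{mod}\Gamma$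 $$0\to\operatorname{Hom}_{\mathcal T}(T,\tau X)\xrightarrow{\operatorname{Hom}(T,f)}\operatorname{Hom}_{\mathcal T}(T,Y)\xrightarrow{\operatorname{Hom}(T,g)}\operatorname{Hom}_{\mathcal T}(T,X)\to 0,$$ i.e. this sequence is exact, its end terms are indecomposable, $\operatorname{Hom}(T,f)$ is left almost split and $\operatorname{Hom}(T,g)$ is right almost split in $\operatorname{mod}\Gamma$. 2. The quotient functor thus preserves the AR-structure in the following sense: if $\operatorname{Hom}_{\mathcal T}(T,X)$ is not projective and $\operatorname{Hom}_{\mathcal T}(T,\tau X)$ is not injective in $\operatorname{mod}\Gamma$, then the sequence in 1 is an AR-sequence in $\operatorname{mod}\Gamma$. -/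

import Mathlib

open CategoryTheory CategoryTheory.Limits CategoryTheory.Pretriangulated

universe w v u

/-- A `k`-linear category is Hom-finite if all its Hom spaces are finite-dimensional over `k`. -/
class IsHomFinite (k : Type w) [Field k] (C : Type u) [Category.{v} C] [Preadditive C]
    [Linear k C] : Prop where
  finite_hom : ∀ X Y : C, Module.Finite k (X ⟶ Y)

/-- A Krull-Schmidt category: every object is a finite direct sum of objects with local
endomorphism rings (the zero object is the empty sum). -/
class IsKrullSchmidt (C : Type u) [Category.{v} C] [Preadditive C] [HasFiniteBiproducts C] :
    Prop where
  exists_decomposition : ∀ X : C, ∃ (n : ℕ) (Y : Fin n → C),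
    (∀ i, IsLocalRing (End (Y i))) ∧ Nonempty (X ≅ ⨁ Y)

/-- `X ∈ add T`: the object `X` is a direct summand of a finite direct sum of copies of `T`. -/
def IsInAdd {C : Type u} [Category.{v} C] [Preadditive C] [HasFiniteBiproducts C]
    [HasBinaryBiproducts C] (T X : C) : Prop :=
  ∃ (n : ℕ) (Z : C), Nonempty ((⨁ fun _ : Fin n => T) ≅ X ⊞ Z)

/-- `X` is `T`-supported: `Hom(T, X) ≠ 0`. -/
def IsSupported {C : Type u} [Category.{v} C] [Preadditive C] (T X : C) : Prop :=
  ∃ f : T ⟶ X, f ≠ 0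

/-- `g : B ⟶ C` is right almost split: it is not a split epimorphism, and every morphism to `C`
that is not a split epimorphism factors through `g`. -/
structure IsRightAlmostSplit {D : Type u} [Category.{v} D] {B C : D} (g : B ⟶ C) : Prop where
  not_isSplitEpi : ¬ IsSplitEpi g
  factors : ∀ ⦃W : D⦄ (t : W ⟶ C), ¬ IsSplitEpi t → ∃ s : W ⟶ B, s ≫ g = t

/-- `f : A ⟶ B` is left almost split: it is not a split monomorphism, and every morphism from `A`
that is not a split monomorphism factors through `f`. -/
structure IsLeftAlmostSplit {D : Type u} [Category.{v} D] {A B : D} (f : A ⟶ B) : Prop where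
  not_isSplitMono : ¬ IsSplitMono f
  factors : ∀ ⦃W : D⦄ (t : A ⟶ W), ¬ IsSplitMono t → ∃ s : B ⟶ W, f ≫ s = t

/-- An Auslander-Reiten triangle `A ⟶ B ⟶ C ⟶ ΣA` in the sense of Happel: it is distinguished,
`A` and `C` are indecomposable, `C ⟶ ΣA` is nonzero, and every morphism to `C` that is not a split
epimorphism factors through `B ⟶ C`. -/
structure IsARTriangle {C : Type u} [Category.{v} C] [Preadditive C] [HasZeroObject C]
    [HasShift C ℤ] [∀ n : ℤ, (shiftFunctor C n).Additive] [Pretriangulated C]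
    (Δ : Triangle C) : Prop where
  distinguished : Δ ∈ distTriang C
  indecomposable₁ : Indecomposable Δ.obj₁
  indecomposable₃ : Indecomposable Δ.obj₃
  mor₃_ne_zero : Δ.mor₃ ≠ 0
  factors : ∀ ⦃W : C⦄ (t : W ⟶ Δ.obj₃), ¬ IsSplitEpi t → ∃ s : W ⟶ Δ.obj₂, s ≫ Δ.mor₂ = t

/-- `0 ⟶ A ⟶ B ⟶ C ⟶ 0` is an Auslander-Reiten (almost split) sequence in the category of finitely
generated `R`-modules: it is exact, `A` and `C` are indecomposable, `A ⟶ B` is left almost split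
and `B ⟶ C` is right almost split. -/
structure IsARSequence {R : Type v} [Ring R] {A B C : FGModuleCat.{v} R}
    (f : A ⟶ B) (g : B ⟶ C) : Prop where
  injective : Function.Injective f.hom.hom
  exact : Function.Exact f.hom.hom g.hom.hom
  surjective : Function.Surjective g.hom.hom
  indecomposable_left : Indecomposable A.obj
  indecomposable_right : Indecomposable C.obj
  isLeftAlmostSplit : IsLeftAlmostSplit f
  isRightAlmostSplit : IsRightAlmostSplit g

/-- In a Hom-finite category, `Hom(T, X)` is finitely generated over `Γ = End(T)ᵒᵖ`. -/
theorem isFG_preadditiveCoyonedaObj (k : Type w) [Field k] {C : Type u} [Category.{v} C]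
    [Preadditive C] [Linear k C] [IsHomFinite k C] (T X : C) :
    ModuleCat.isFG (End T)ᵐᵒᵖ ((preadditiveCoyonedaObj T).obj X) := by
  have hfin : Module.Finite k (T ⟶ X) := IsHomFinite.finite_hom T X
  obtain ⟨S, hS⟩ := hfin.fg_top
  refine ⟨⟨S, ?_⟩⟩
  rw [eq_top_iff]
  rintro (x : T ⟶ X) -
  have hx : x ∈ Submodule.span k (S : Set (T ⟶ X)) := by rw [hS]; trivial
  induction hx using Submodule.span_induction with
  | mem y hy => exact Submodule.subset_span hy
  | zero => exact Submodule.zero_mem _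
  | add y z _ _ hy hz => exact Submodule.add_mem _ hy hz
  | smul a y _ hy =>
    let e : End T := a • 𝟙 T
    have h : a • y = e ≫ y := by simp [e]
    rw [h]
    exact Submodule.smul_mem _ (MulOpposite.op e) hy

/-- The functor `Hom(T, -) : C ⥤ mod Γ`, where `Γ = End(T)ᵒᵖ` acts on `Hom(T, X)` by composition
with endomorphisms of `T` and `mod Γ` is the category of finitely generated left `Γ`-modules. -/
noncomputable def homFunctor (k : Type w) [Field k] {C : Type u} [Category.{v} C]
    [Preadditive C] [Linear k C] [IsHomFinite k C] (T : C) :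
    C ⥤ FGModuleCat.{v} (End T)ᵐᵒᵖ :=
  ObjectProperty.lift _ (preadditiveCoyonedaObj T) (isFG_preadditiveCoyonedaObj k T)

/-!
Write `F = Hom(T, -)` and let `A ⟶ B ⟶ X ⟶ ΣA` be the Auslander-Reiten triangle.

*Transport along `F`.* Since the category is Krull-Schmidt and split monomorphisms in a triangulated
category have complements, the endomorphism rings of `A` and `X` are local
(`Indecomposable.hasLocalEnd`). Fullness of `F` turns their nonzero images into objects whose
endomorphism rings are quotients of local rings: the images are indecomposable
(`HasLocalEnd.indecomposable_map`), and a morphism from `A` or to `X` splits as soon as its image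
does. As every module is isomorphic to some `F W` and every map of modules lifts, right almost
splitness of `B ⟶ X` and left almost splitness of `A ⟶ B` descend to `mod Γ`. Left almost splitness
in the triangulated category is not part of the definition and is derived in
`IsARTriangle.isLeftAlmostSplit`.

*Exactness.* `F` is homological, so only the two ends matter. A morphism `T ⟶ X` lifts to `B` unless
it is a split epimorphism, in which case `X ∈ add T`. A morphism `T ⟶ A` killed in `B` factors
through the connecting morphism `δ : Σ⁻¹X ⟶ A`, and `δ` is annihilated by every morphism to `Σ⁻¹X`
that is not a split epimorphism; a split one would give `Σ⁻¹X ∈ add T`.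

*Projectives and injectives.* If `X ∈ add T`, then `F X` is projective. If `Σ⁻¹X ∈ add T`, then
`F A` is injective, by a local form of Serre duality: a functional `ψ` on `Hom(Σ⁻¹X, A)` with
`ψ δ ≠ 0` induces perfect pairings `Hom(Σ⁻¹X, W) × Hom(W, A) ⟶ k`, because every nonzero morphism on
either side can be completed to a factorization of `δ`. So `Hom(-, A)` is the `k`-dual of
`Hom(Σ⁻¹X, -)`, and morphisms to `A` extend along every `M ⟶ N` that is injective on `Hom(Σ⁻¹X, -)`
(`IsARTriangle.exists_extension`). Hence nonprojectivity of `F X` and noninjectivity of `F A` imply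
the hypotheses `X ∉ add T` and `Σ⁻¹X ∉ add T` used for exactness.
-/

/-! ### Local endomorphism rings and full additive functors -/

section Local

variable {C : Type u} [Category.{v} C] [Preadditive C]

/-- For every endomorphism `a` of `X`, either `a` or `𝟙 X - a` is invertible. For `X ≠ 0` this says
that `End X` is a local ring; zero objects are allowed. -/
def HasLocalEnd (X : C) : Prop :=
  ∀ a : X ⟶ X, IsIso a ∨ IsIso (𝟙 X - a)

theorem HasLocalEnd.of_iso {X Y : C} (e : Y ≅ X) (hY : IsLocalRing (End Y)) : HasLocalEnd X := by
  intro a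
  let b : End Y := e.hom ≫ a ≫ e.inv
  have key (c : X ⟶ X) (h : IsIso (e.hom ≫ c ≫ e.inv)) : IsIso c := by
    have : c = e.inv ≫ (e.hom ≫ c ≫ e.inv) ≫ e.hom := by simp
    rw [this]; infer_instance
  rcases hY.isUnit_or_isUnit_of_add_one (add_sub_cancel b 1) with h | h
  · exact Or.inl (key a ((isUnit_iff_isIso b).1 h))
  · refine Or.inr (key _ ?_)
    have h' : e.hom ≫ (𝟙 X - a) ≫ e.inv = (1 : End Y) - b := by
      simp only [Preadditive.sub_comp, Preadditive.comp_sub, Category.id_comp, e.hom_inv_id]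
      rfl
    rw [h']
    exact (isUnit_iff_isIso _).1 h

variable {D : Type*} [Category D] [Preadditive D] (G : C ⥤ D) [G.Additive]

theorem HasLocalEnd.isIso_of_map_eq_id {X : C} (hX : HasLocalEnd X) (hGX : ¬ IsZero (G.obj X))
    {a : X ⟶ X} (ha : G.map a = 𝟙 _) : IsIso a := by
  refine (hX a).resolve_right fun h => hGX ?_
  have h0 : G.map (𝟙 X - a) = 0 := by rw [G.map_sub, G.map_id, ha, sub_self]
  have : IsIso (G.map (𝟙 X - a)) := inferInstance
  rw [h0] at this
  exact IsZero.of_epi_eq_zero _ h0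

variable [G.Full]

theorem HasLocalEnd.isSplitEpi_of_map {W X : C} (hX : HasLocalEnd X) (hGX : ¬ IsZero (G.obj X))
    {g : W ⟶ X} (hg : IsSplitEpi (G.map g)) : IsSplitEpi g := by
  obtain ⟨s, hs⟩ := G.map_surjective (section_ (G.map g))
  have := hX.isIso_of_map_eq_id G hGX (a := s ≫ g) (by rw [G.map_comp, hs, IsSplitEpi.id])
  exact IsSplitEpi.mk' ⟨inv (s ≫ g) ≫ s, by simp⟩

theorem HasLocalEnd.isSplitMono_of_map {X W : C} (hX : HasLocalEnd X) (hGX : ¬ IsZero (G.obj X))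
    {f : X ⟶ W} (hf : IsSplitMono (G.map f)) : IsSplitMono f := by
  obtain ⟨r, hr⟩ := G.map_surjective (retraction (G.map f))
  have := hX.isIso_of_map_eq_id G hGX (a := f ≫ r) (by rw [G.map_comp, hr, IsSplitMono.id])
  exact IsSplitMono.mk' ⟨r ≫ inv (f ≫ r), by
    rw [← Category.assoc, IsIso.hom_inv_id]⟩

/-- A full additive functor sends an object with local endomorphism ring to an indecomposable
object or to zero: the idempotents of a decomposition of `G X` lift to endomorphisms of `X`. -/
theorem HasLocalEnd.indecomposable_map [HasBinaryBiproducts D] {X : C} (hX : HasLocalEnd X)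
    (hGX : ¬ IsZero (G.obj X)) : Indecomposable (G.obj X) := by
  refine ⟨hGX, fun Y Z e => ?_⟩
  obtain ⟨a, ha⟩ := G.map_surjective (e.hom ≫ biprod.fst ≫ biprod.inl ≫ e.inv)
  have ha' : G.map (𝟙 X - a) = e.hom ≫ biprod.snd ≫ biprod.inr ≫ e.inv := by
    have h : 𝟙 (G.obj X) = e.hom ≫ (biprod.fst ≫ biprod.inl + biprod.snd ≫ biprod.inr) ≫ e.inv := by
      rw [biprod.total]; simp
    rw [G.map_sub, G.map_id, ha, h]
    simp only [Preadditive.add_comp, Preadditive.comp_add, Category.assoc, add_sub_cancel_left]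
  rcases hX a with h | h
  · right
    have h1 : (biprod.inr : Z ⟶ Y ⊞ Z) ≫ e.inv ≫ G.map a = 0 := by rw [ha]; simp
    have h2 : (biprod.inr : Z ⟶ Y ⊞ Z) = 0 := by
      rw [← cancel_mono (e.inv ≫ G.map a), h1, zero_comp]
    exact IsZero.of_mono_eq_zero _ h2
  · left
    have h1 : (biprod.inl : Y ⟶ Y ⊞ Z) ≫ e.inv ≫ G.map (𝟙 X - a) = 0 := by rw [ha']; simp
    have h2 : (biprod.inl : Y ⟶ Y ⊞ Z) = 0 := by
      rw [← cancel_mono (e.inv ≫ G.map (𝟙 X - a)), h1, zero_comp]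
    exact IsZero.of_mono_eq_zero _ h2

end Local

/-! ### Split morphisms and `add T` in a triangulated category -/

section Triangulated

variable {C : Type u} [Category.{v} C] [Preadditive C] [HasZeroObject C] [HasShift C ℤ]
  [∀ n : ℤ, (shiftFunctor C n).Additive] [Pretriangulated C]

/-- A split monomorphism in a triangulated category has a complement, namely its cone. -/
theorem exists_iso_biprod_of_isSplitMono {X Y : C} (i : Y ⟶ X) [IsSplitMono i] :
    ∃ (Z : C), Nonempty (X ≅ Y ⊞ Z) ∧ (IsZero Z → IsIso i) := by
  obtain ⟨Z, g, h, hT⟩ := distinguished_cocone_triangle i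
  have h0 : h = 0 := Triangle.mor₃_eq_zero_of_mono₁ _ hT (inferInstanceAs (Mono i))
  obtain ⟨e, -⟩ := exists_iso_binaryBiproduct_of_distTriang _ hT h0
  exact ⟨Z, ⟨e⟩, (Triangle.isZero₃_iff_isIso₁ _ hT).1⟩

theorem CategoryTheory.Indecomposable.hasLocalEnd [IsKrullSchmidt C] {X : C}
    (hX : Indecomposable X) : HasLocalEnd X := by
  obtain ⟨n, Y, hY, ⟨e⟩⟩ := IsKrullSchmidt.exists_decomposition X
  rcases Nat.eq_zero_or_pos n with rfl | hn
  · refine absurd ?_ hX.1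
    rw [IsZero.iff_id_eq_zero, ← cancel_mono e.hom]
    exact biproduct.hom_ext _ _ fun j => j.elim0
  · let i : Y ⟨0, hn⟩ ⟶ X := biproduct.ι Y ⟨0, hn⟩ ≫ e.inv
    have : IsSplitMono i := inferInstance
    obtain ⟨Z, ⟨e'⟩, hZ⟩ := exists_iso_biprod_of_isSplitMono i
    have := (hY ⟨0, hn⟩)
    have h0 : ¬ IsZero (Y ⟨0, hn⟩) := fun h =>
      one_ne_zero (α := End (Y ⟨0, hn⟩)) (h.eq_of_src _ _)
    have := hZ ((hX.2 _ _ e').resolve_left h0)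
    exact HasLocalEnd.of_iso (asIso i) (hY _)

theorem IsInAdd.of_isSplitEpi {T X : C} (t : T ⟶ X) [IsSplitEpi t] : IsInAdd T X := by
  obtain ⟨Z, ⟨e⟩, -⟩ := exists_iso_biprod_of_isSplitMono (section_ t)
  exact ⟨1, Z, ⟨(biproductUniqueIso (fun _ : Fin 1 => T)) ≪≫ e⟩⟩

theorem IsInAdd.exists_retract {T X : C} (h : IsInAdd T X) :
    ∃ (n : ℕ) (s : X ⟶ ⨁ fun _ : Fin n => T) (p : (⨁ fun _ : Fin n => T) ⟶ X), s ≫ p = 𝟙 X := by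
  obtain ⟨n, Z, ⟨e⟩⟩ := h
  exact ⟨n, biprod.inl ≫ e.inv, e.hom ≫ biprod.fst, by simp⟩

/-! ### Auslander-Reiten triangles -/

variable {Δ : Triangle C}

theorem IsARTriangle.comp_mor₃_eq_zero (hΔ : IsARTriangle Δ) {W : C} (t : W ⟶ Δ.obj₃)
    (ht : ¬ IsSplitEpi t) : t ≫ Δ.mor₃ = 0 := by
  obtain ⟨s, rfl⟩ := hΔ.factors t ht
  rw [Category.assoc, comp_distTriang_mor_zero₂₃ _ hΔ.distinguished, comp_zero]

theorem IsARTriangle.not_isSplitEpi (hΔ : IsARTriangle Δ) : ¬ IsSplitEpi Δ.mor₂ := fun _ =>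
  hΔ.mor₃_ne_zero (Triangle.mor₃_eq_zero_of_epi₂ _ hΔ.distinguished inferInstance)

theorem IsARTriangle.not_isSplitMono (hΔ : IsARTriangle Δ) : ¬ IsSplitMono Δ.mor₁ := fun _ =>
  hΔ.mor₃_ne_zero (Triangle.mor₃_eq_zero_of_mono₁ _ hΔ.distinguished inferInstance)

/-- The first morphism of an Auslander-Reiten triangle is left almost split. If `t` does not factor
through it, the triangle on `Δ.mor₃ ≫ t⟦1⟧'` is nonsplit, so its second morphism factors through
`Δ.mor₂`; the induced map `φ` satisfies `Δ.mor₃ ≫ (t ≫ φ)⟦1⟧' = Δ.mor₃ ≠ 0`, so `𝟙 - t ≫ φ` is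
not invertible, `t ≫ φ` is, and `t` is a split monomorphism. -/
theorem IsARTriangle.isLeftAlmostSplit [IsKrullSchmidt C] (hΔ : IsARTriangle Δ) :
    IsLeftAlmostSplit Δ.mor₁ := by
  refine ⟨hΔ.not_isSplitMono, fun W t ht => ?_⟩
  obtain ⟨E, i, p, hT⟩ := distinguished_cocone_triangle₂ (Δ.mor₃ ≫ t⟦(1 : ℤ)⟧')
  have hp : IsSplitEpi p := by
    by_contra hp
    obtain ⟨s, hs⟩ := hΔ.factors p hp
    obtain ⟨φ, hφ⟩ : ∃ φ : W ⟶ Δ.obj₁, (Δ.mor₃ ≫ t⟦(1 : ℤ)⟧') ≫ φ⟦(1 : ℤ)⟧' = 𝟙 _ ≫ Δ.mor₃ := by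
      obtain ⟨φ, -, hφ⟩ := complete_distinguished_triangle_morphism₁ _ _ hT hΔ.distinguished
        s (𝟙 Δ.obj₃) ((Category.comp_id p).trans hs.symm)
      exact ⟨φ, hφ⟩
    have hφ' : Δ.mor₃ ≫ (t ≫ φ)⟦(1 : ℤ)⟧' = Δ.mor₃ := by simpa using hφ
    rcases hΔ.indecomposable₁.hasLocalEnd (t ≫ φ) with h | h
    · exact ht (IsSplitMono.mk' ⟨φ ≫ inv (t ≫ φ), by rw [← Category.assoc, IsIso.hom_inv_id]⟩)
    · refine hΔ.mor₃_ne_zero ?_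
      rw [← cancel_mono ((𝟙 Δ.obj₁ - t ≫ φ)⟦(1 : ℤ)⟧'), Functor.map_sub, Preadditive.comp_sub, hφ']
      simp
  have h0 : Δ.mor₃ ≫ t⟦(1 : ℤ)⟧' = 0 :=
    Triangle.mor₃_eq_zero_of_epi₂ _ hT (inferInstanceAs (Epi p))
  -- Since `t⟦1⟧'` kills `Δ.mor₃`, it factors through the next morphism, `-Δ.mor₁⟦1⟧'`.
  obtain ⟨s, hs⟩ := Triangle.yoneda_exact₂ _ (rot_of_distTriang _ (rot_of_distTriang _
    hΔ.distinguished)) (t⟦(1 : ℤ)⟧') h0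
  obtain ⟨s', hs'⟩ : ∃ s' : Δ.obj₂ ⟶ W, s'⟦(1 : ℤ)⟧' = s :=
    (shiftFunctor C (1 : ℤ)).map_surjective s
  refine ⟨-s', (shiftFunctor C (1 : ℤ)).map_injective ?_⟩
  have hs'' : t⟦(1 : ℤ)⟧' = (-Δ.mor₁⟦(1 : ℤ)⟧') ≫ s'⟦(1 : ℤ)⟧' := by rw [hs, hs']; rfl
  rw [hs'', Functor.map_comp, Functor.map_neg, Preadditive.comp_neg, Preadditive.neg_comp]

/-- The connecting morphism `Σ⁻¹Z ⟶ X` of a triangle `X ⟶ Y ⟶ Z ⟶ ΣX`, with the sign of the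
inverse rotation: it is minus the desuspension of `Z ⟶ ΣX`. -/
noncomputable def connectingHom (Δ : Triangle C) :
    Δ.obj₃⟦(-1 : ℤ)⟧ ⟶ Δ.obj₁ :=
  Δ.invRotate.mor₁

theorem connectingHom_comp_mor₁ (hΔ : Δ ∈ distTriang C) :
    connectingHom Δ ≫ Δ.mor₁ = 0 :=
  comp_distTriang_mor_zero₁₂ _ (inv_rot_of_distTriang _ hΔ)

theorem exists_comp_connectingHom_eq (hΔ : Δ ∈ distTriang C)
    {W : C} (t : W ⟶ Δ.obj₁) (ht : t ≫ Δ.mor₁ = 0) :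
    ∃ s : W ⟶ Δ.obj₃⟦(-1 : ℤ)⟧, t = s ≫ connectingHom Δ :=
  Triangle.coyoneda_exact₂ _ (inv_rot_of_distTriang _ hΔ) t ht

/-- Over an Auslander-Reiten triangle, the connecting morphism is annihilated by every morphism to
its source that is not a split epimorphism: this is the factorization property, desuspended. -/
theorem IsARTriangle.comp_connectingHom_eq_zero (hΔ : IsARTriangle Δ) {W : C}
    (t : W ⟶ Δ.obj₃⟦(-1 : ℤ)⟧) (ht : ¬ IsSplitEpi t) : t ≫ connectingHom Δ = 0 := by
  let e : W ≅ (W⟦(1 : ℤ)⟧)⟦(-1 : ℤ)⟧ := (shiftEquiv C (1 : ℤ)).unitIso.app W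
  obtain ⟨t', ht'⟩ := (shiftFunctor C (-1 : ℤ)).map_surjective (e.inv ≫ t)
  have h : t = e.hom ≫ t'⟦(-1 : ℤ)⟧' := by rw [ht']; simp
  have h' : ¬ IsSplitEpi t' := fun _ => ht <| IsSplitEpi.mk'
    ⟨(section_ t')⟦(-1 : ℤ)⟧' ≫ e.inv, by
      rw [h, Category.assoc, e.inv_hom_id_assoc, ← Functor.map_comp, IsSplitEpi.id,
        CategoryTheory.Functor.map_id]⟩
  have h0 : t'⟦(-1 : ℤ)⟧' ≫ Δ.mor₃⟦(-1 : ℤ)⟧' = 0 := by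
    rw [← Functor.map_comp, hΔ.comp_mor₃_eq_zero t' h', Functor.map_zero]
  obtain ⟨c, hc⟩ : ∃ c : (Δ.obj₁⟦(1 : ℤ)⟧)⟦(-1 : ℤ)⟧ ⟶ Δ.obj₁,
      connectingHom Δ = -(Δ.mor₃⟦(-1 : ℤ)⟧' ≫ c) :=
    ⟨(shiftEquiv C (1 : ℤ)).unitIso.inv.app Δ.obj₁, rfl⟩
  have h1 : t ≫ Δ.mor₃⟦(-1 : ℤ)⟧' = 0 := by rw [h, Category.assoc, h0, comp_zero]
  rw [hc, Preadditive.comp_neg, ← Category.assoc, h1, zero_comp, neg_zero]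

/-- A nonzero `a : Σ⁻¹X ⟶ W` divides the connecting morphism: the fibre `V ⟶ Σ⁻¹X` of `a` is not a
split epimorphism, so it annihilates the connecting morphism. -/
theorem IsARTriangle.exists_comp_eq_of_ne_zero_left (hΔ : IsARTriangle Δ) {W : C}
    {a : Δ.obj₃⟦(-1 : ℤ)⟧ ⟶ W} (ha : a ≠ 0) : ∃ b : W ⟶ Δ.obj₁, a ≫ b = connectingHom Δ := by
  obtain ⟨V, c, d, hT⟩ := distinguished_cocone_triangle₁ a
  have hc : ¬ IsSplitEpi c := fun _ =>
    ha (Triangle.mor₂_eq_zero_of_epi₁ _ hT (inferInstanceAs (Epi c)))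
  obtain ⟨b, hb⟩ := Triangle.yoneda_exact₂ _ hT _ (hΔ.comp_connectingHom_eq_zero c hc)
  exact ⟨b, hb.symm⟩

/-- A nonzero `b : W ⟶ τX` divides the connecting morphism: the cone `τX ⟶ V` of `b` is not a split
monomorphism, so it factors through `Δ.mor₁`, which annihilates the connecting morphism. -/
theorem IsARTriangle.exists_comp_eq_of_ne_zero_right [IsKrullSchmidt C] (hΔ : IsARTriangle Δ)
    {W : C} {b : W ⟶ Δ.obj₁} (hb : b ≠ 0) :
    ∃ a : Δ.obj₃⟦(-1 : ℤ)⟧ ⟶ W, a ≫ b = connectingHom Δ := by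
  obtain ⟨V, c, d, hT⟩ := distinguished_cocone_triangle b
  have hc : ¬ IsSplitMono c := fun _ =>
    hb (Triangle.mor₁_eq_zero_of_mono₂ _ hT (inferInstanceAs (Mono c)))
  obtain ⟨s, rfl⟩ := hΔ.isLeftAlmostSplit.factors c hc
  obtain ⟨a, ha⟩ := Triangle.coyoneda_exact₂ _ hT (connectingHom Δ)
    (by change _ ≫ Δ.mor₁ ≫ s = 0
        rw [← Category.assoc, connectingHom_comp_mor₁ hΔ.distinguished, zero_comp])
  exact ⟨a, ha.symm⟩

theorem IsARTriangle.connectingHom_ne_zero (hΔ : IsARTriangle Δ) : connectingHom Δ ≠ 0 :=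
  fun h => hΔ.mor₃_ne_zero (Triangle.mor₃_eq_zero_of_mono₁ _ hΔ.distinguished
    (Triangle.mono₂ _ (inv_rot_of_distTriang _ hΔ.distinguished) h))

/-- A functional on `Hom(Σ⁻¹X, τX)` that does not vanish on the connecting morphism makes
`Hom(Σ⁻¹X, W) × Hom(W, τX) ⟶ k` a perfect pairing for all `W`. Therefore a morphism to `τX` extends
along every `i` that is injective on `Hom(Σ⁻¹X, -)`: extend the corresponding functional. -/
theorem IsARTriangle.exists_extension (k : Type w) [Field k] [Linear k C]
    [IsHomFinite k C] [IsKrullSchmidt C] (hΔ : IsARTriangle Δ) {M N : C} (i : M ⟶ N)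
    (hi : ∀ a : Δ.obj₃⟦(-1 : ℤ)⟧ ⟶ M, a ≫ i = 0 → a = 0) (u : M ⟶ Δ.obj₁) :
    ∃ v : N ⟶ Δ.obj₁, i ≫ v = u := by
  let P := Δ.obj₃⟦(-1 : ℤ)⟧
  have hfin (X Y : C) : Module.Finite k (X ⟶ Y) := IsHomFinite.finite_hom X Y
  obtain ⟨ψ, hψ⟩ : ∃ ψ : Module.Dual k (P ⟶ Δ.obj₁), ψ (connectingHom Δ) ≠ 0 := by
    by_contra! h
    exact hΔ.connectingHom_ne_zero ((Module.forall_dual_apply_eq_zero_iff k _).1 h)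
  let B (W : C) : (P ⟶ W) →ₗ[k] (W ⟶ Δ.obj₁) →ₗ[k] k := (Linear.comp P W Δ.obj₁).compr₂ ψ
  have hB (W : C) (a : P ⟶ W) (b : W ⟶ Δ.obj₁) : B W a b = ψ (a ≫ b) := rfl
  have hleft : Function.Injective (B N) := by
    rw [injective_iff_map_eq_zero]
    intro a ha
    by_contra h
    obtain ⟨b, hb⟩ := hΔ.exists_comp_eq_of_ne_zero_left h
    exact hψ (by rw [← hb, ← hB, ha]; rfl)
  -- In finite dimension, injectivity of one adjoint of the pairing is surjectivity of the other.
  have hsurj : Function.Surjective (B N).flip := LinearMap.flip_surjective_iff₁.2 hleft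
  -- Extend the functional `a ↦ ψ (a ≫ u)` along `a ↦ a ≫ i` and represent the result by some `v`.
  have hinj : Function.Injective (Linear.rightComp k P i) := by
    rw [injective_iff_map_eq_zero]
    exact hi
  obtain ⟨θ, hθ⟩ := LinearMap.dualMap_surjective_of_injective hinj ((B M).flip u)
  obtain ⟨v, rfl⟩ := hsurj θ
  refine ⟨v, ?_⟩
  by_contra h
  obtain ⟨a, ha⟩ := hΔ.exists_comp_eq_of_ne_zero_right (sub_ne_zero.2 h)
  refine hψ ?_
  have := DFunLike.congr_fun hθ a
  have h' : ψ ((a ≫ i) ≫ v) = ψ (a ≫ u) := this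
  rw [← ha, Preadditive.comp_sub, map_sub, ← Category.assoc, h', sub_self]

end Triangulated

/-! ### The functor `Hom(T, -)` -/

/-- Epimorphisms of finitely generated modules are surjective over any ring, as the cokernel is
again finitely generated. -/
theorem FGModuleCat.surjective_of_epi {R : Type v} [Ring R] {M N : FGModuleCat.{v} R} (f : M ⟶ N)
    [Epi f] : Function.Surjective f.hom.hom := by
  let q : N ⟶ FGModuleCat.of R (N ⧸ f.hom.hom.range) :=
    FGModuleCat.ofHom f.hom.hom.range.mkQ
  let z : N ⟶ FGModuleCat.of R (N ⧸ f.hom.hom.range) :=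
    FGModuleCat.ofHom 0
  have h : q = z := by
    rw [← cancel_epi f]
    apply FGModuleCat.hom_ext
    exact LinearMap.range_mkQ_comp _
  have h' : f.hom.hom.range.mkQ = 0 := congrArg (fun t => t.hom.hom) h
  rw [← LinearMap.range_eq_top, ← Submodule.ker_mkQ f.hom.hom.range, h', LinearMap.ker_zero]

section HomFunctor

variable (k : Type w) [Field k] {C : Type u} [Category.{v} C]
    [Preadditive C] [Linear k C] [IsHomFinite k C] (T : C)

instance : (homFunctor k T).Additive where
  map_add {X Y f g} := by
    apply FGModuleCat.hom_ext
    apply LinearMap.ext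
    intro x
    exact Preadditive.comp_add _ _ _ x f g

theorem not_isZero_homFunctor_obj_obj {X : C} (hX : IsSupported T X) :
    ¬ IsZero ((homFunctor k T).obj X).obj := by
  obtain ⟨x, hx⟩ := hX
  intro h
  have h' := ModuleCat.subsingleton_of_isZero h
  exact hx (h'.elim x 0)

theorem not_isZero_homFunctor_obj {X : C} (hX : IsSupported T X) :
    ¬ IsZero ((homFunctor k T).obj X) := fun h =>
  not_isZero_homFunctor_obj_obj k T hX ((ModuleCat.isFG (End T)ᵐᵒᵖ).ι.map_isZero h)

/-- A supported object with local endomorphism ring has indecomposable image, even when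
decompositions into modules that are not assumed finitely generated are allowed. -/
theorem HasLocalEnd.indecomposable_homFunctor_obj [(homFunctor k T).Full] {X : C}
    (hX : HasLocalEnd X) (hTX : IsSupported T X) :
    Indecomposable ((homFunctor k T).obj X).obj :=
  hX.indecomposable_map (homFunctor k T ⋙ (ModuleCat.isFG (End T)ᵐᵒᵖ).ι)
    (not_isZero_homFunctor_obj_obj k T hTX)

end HomFunctor

/-! ### Projective and injective images -/

section AddT

variable {C : Type u} [Category.{v} C] [Preadditive C] [HasZeroObject C] [HasShift C ℤ]
  [∀ n : ℤ, (shiftFunctor C n).Additive] [Pretriangulated C] {T P : C}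

/-- `Hom(T, -)` is faithful on morphisms out of an object of `add T`. -/
theorem IsInAdd.hom_ext (hP : IsInAdd T P) {X : C} {a b : P ⟶ X}
    (h : ∀ x : T ⟶ P, x ≫ a = x ≫ b) : a = b := by
  obtain ⟨n, s, p, hsp⟩ := hP.exists_retract
  have hp : p ≫ a = p ≫ b := biproduct.hom_ext' _ _ fun j => by
    simpa using h (biproduct.ι (fun _ : Fin n => T) j ≫ p)
  rw [← Category.id_comp a, ← Category.id_comp b, ← hsp, Category.assoc, hp, Category.assoc]

/-- Morphisms out of an object of `add T` lift along every morphism that is surjective on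
`Hom(T, -)`. -/
theorem IsInAdd.exists_lift (hP : IsInAdd T P) {M N : C} (e : M ⟶ N)
    (he : ∀ x : T ⟶ N, ∃ y : T ⟶ M, y ≫ e = x) (u : P ⟶ N) : ∃ v : P ⟶ M, v ≫ e = u := by
  obtain ⟨n, s, p, hsp⟩ := hP.exists_retract
  choose y hy using fun j => he (biproduct.ι (fun _ : Fin n => T) j ≫ p ≫ u)
  refine ⟨s ≫ biproduct.desc y, ?_⟩
  have h : biproduct.desc y ≫ e = p ≫ u := biproduct.hom_ext' _ _ fun j => by simp [hy]
  rw [Category.assoc, h, ← Category.assoc, hsp, Category.id_comp]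

variable (k : Type w) [Field k] [Linear k C] [IsHomFinite k C]

theorem IsInAdd.projective_homFunctor_obj [(homFunctor k T).Full] [(homFunctor k T).EssSurj]
    (hP : IsInAdd T P) : Projective ((homFunctor k T).obj P) := by
  let F := homFunctor k T
  refine ⟨fun {E M} u e _ => ?_⟩
  let α := F.objObjPreimageIso E
  let β := F.objObjPreimageIso M
  obtain ⟨u', hu⟩ := F.map_surjective (u ≫ β.inv)
  obtain ⟨e', he⟩ := F.map_surjective (α.hom ≫ e ≫ β.inv)
  have : Epi (F.map e') := by rw [he]; infer_instance
  obtain ⟨v, hv⟩ := hP.exists_lift e' (FGModuleCat.surjective_of_epi (F.map e')) u'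
  refine ⟨F.map v ≫ α.hom, ?_⟩
  rw [← cancel_mono β.inv, Category.assoc, Category.assoc, ← he, ← F.map_comp, hv, hu]

/-- If `Σ⁻¹X` lies in `add T`, then `Hom(T, τX)` is injective. Testing against `M ⟶ N` reduces to
`IsARTriangle.exists_extension`, since a monomorphism in `mod Γ` between images of objects of `C` is
injective on `Hom(Σ⁻¹X, -)`. -/
theorem IsARTriangle.injective_homFunctor_obj [IsKrullSchmidt C] [(homFunctor k T).Full]
    [(homFunctor k T).EssSurj] {Δ : Triangle C} (hΔ : IsARTriangle Δ)
    (hP : IsInAdd T (Δ.obj₃⟦(-1 : ℤ)⟧)) : Injective ((homFunctor k T).obj Δ.obj₁) := by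
  let F := homFunctor k T
  refine ⟨fun {M N} u i _ => ?_⟩
  let α := F.objObjPreimageIso M
  let β := F.objObjPreimageIso N
  obtain ⟨u', hu⟩ := F.map_surjective (α.hom ≫ u)
  obtain ⟨i', hi⟩ := F.map_surjective (α.hom ≫ i ≫ β.inv)
  have : Mono (F.map i') := by rw [hi]; infer_instance
  obtain ⟨v, hv⟩ := hΔ.exists_extension k i' (fun a ha => by
    have h0 : F.map a = F.map 0 := by
      rw [← cancel_mono (F.map i'), ← F.map_comp, ← F.map_comp, ha, zero_comp]
    exact hP.hom_ext fun x => congrArg (fun t => t.hom.hom x) h0) u'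
  refine ⟨β.inv ≫ F.map v, ?_⟩
  rw [← cancel_epi α.hom, ← hu, ← hv, F.map_comp, hi]
  simp

end AddT

/-! ### The image of an Auslander-Reiten triangle -/

section ARSequence

variable (k : Type w) [Field k] {C : Type u} [Category.{v} C] [Preadditive C]
  [Linear k C] [HasZeroObject C] [HasShift C ℤ] [∀ n : ℤ, (shiftFunctor C n).Additive]
  [Pretriangulated C] [IsHomFinite k C] [IsKrullSchmidt C] {T : C}
  [(homFunctor k T).Full] [(homFunctor k T).EssSurj] {Δ : Triangle C}

theorem IsARTriangle.isRightAlmostSplit_map (hΔ : IsARTriangle Δ) (hX : IsSupported T Δ.obj₃) :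
    IsRightAlmostSplit ((homFunctor k T).map Δ.mor₂) := by
  let F := homFunctor k T
  refine ⟨fun h => hΔ.not_isSplitEpi (hΔ.indecomposable₃.hasLocalEnd.isSplitEpi_of_map F
    (not_isZero_homFunctor_obj k T hX) h), fun W t ht => ?_⟩
  let α := F.objObjPreimageIso W
  obtain ⟨t', h⟩ := F.map_surjective (α.hom ≫ t)
  have ht' : ¬ IsSplitEpi t' := fun _ => ht <| IsSplitEpi.mk'
    ⟨F.map (section_ t') ≫ α.hom, by
      rw [Category.assoc, ← h, ← F.map_comp, IsSplitEpi.id, F.map_id]⟩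
  obtain ⟨s, hs⟩ := hΔ.factors t' ht'
  refine ⟨α.inv ≫ F.map s, ?_⟩
  rw [Category.assoc, ← F.map_comp, hs, h, α.inv_hom_id_assoc]

theorem IsARTriangle.isLeftAlmostSplit_map (hΔ : IsARTriangle Δ) (hX : IsSupported T Δ.obj₁) :
    IsLeftAlmostSplit ((homFunctor k T).map Δ.mor₁) := by
  let F := homFunctor k T
  refine ⟨fun h => hΔ.not_isSplitMono (hΔ.indecomposable₁.hasLocalEnd.isSplitMono_of_map F
    (not_isZero_homFunctor_obj k T hX) h), fun W t ht => ?_⟩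
  let α := F.objObjPreimageIso W
  obtain ⟨t', h⟩ := F.map_surjective (t ≫ α.inv)
  have ht' : ¬ IsSplitMono t' := fun _ => ht <| IsSplitMono.mk'
    ⟨α.inv ≫ F.map (retraction t'), by
      rw [← Category.assoc, ← h, ← F.map_comp, IsSplitMono.id, F.map_id]⟩
  obtain ⟨s, hs⟩ := hΔ.isLeftAlmostSplit.factors t' ht'
  refine ⟨F.map s ≫ α.hom, ?_⟩
  rw [← Category.assoc, ← F.map_comp, hs, h, Category.assoc, α.inv_hom_id, Category.comp_id]

theorem IsARTriangle.isARSequence_map (hΔ : IsARTriangle Δ) (hX : IsSupported T Δ.obj₃)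
    (hτX : IsSupported T Δ.obj₁) (h : ¬ IsInAdd T Δ.obj₃)
    (h' : ¬ IsInAdd T (Δ.obj₃⟦(-1 : ℤ)⟧)) :
    IsARSequence ((homFunctor k T).map Δ.mor₁) ((homFunctor k T).map Δ.mor₂) where
  injective := by
    rw [injective_iff_map_eq_zero]
    intro (x : T ⟶ Δ.obj₁) (hx : x ≫ Δ.mor₁ = 0)
    obtain ⟨y, rfl⟩ := exists_comp_connectingHom_eq hΔ.distinguished x hx
    exact hΔ.comp_connectingHom_eq_zero y fun _ => h' (IsInAdd.of_isSplitEpi y)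
  exact := by
    intro (y : T ⟶ Δ.obj₂)
    constructor
    · intro (hy : y ≫ Δ.mor₂ = 0)
      obtain ⟨x, rfl⟩ := Triangle.coyoneda_exact₂ _ hΔ.distinguished y hy
      exact ⟨x, rfl⟩
    · rintro ⟨(x : T ⟶ Δ.obj₁), rfl⟩
      change (x ≫ Δ.mor₁) ≫ Δ.mor₂ = 0
      rw [Category.assoc, comp_distTriang_mor_zero₁₂ _ hΔ.distinguished, comp_zero]
  surjective := fun x => hΔ.factors (W := T) x fun _ => h (IsInAdd.of_isSplitEpi (T := T) x)
  indecomposable_left := hΔ.indecomposable₁.hasLocalEnd.indecomposable_homFunctor_obj k T hτX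
  indecomposable_right := hΔ.indecomposable₃.hasLocalEnd.indecomposable_homFunctor_obj k T hX
  isLeftAlmostSplit := hΔ.isLeftAlmostSplit_map k hτX
  isRightAlmostSplit := hΔ.isRightAlmostSplit_map k hX

end ARSequence

theorem mainTheorem6 (k : Type w) [Field k] {C : Type u} [Category.{v} C] [Preadditive C]
    [Linear k C] [HasZeroObject C] [HasShift C ℤ] [∀ n : ℤ, (shiftFunctor C n).Additive]
    [∀ n : ℤ, (shiftFunctor C n).Linear k] [Pretriangulated C] [IsTriangulated C]
    [IsHomFinite k C] [IsKrullSchmidt C]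
    (T : C) (hfull : (homFunctor k T).Full) (hdense : (homFunctor k T).EssSurj)
    (Δ : Triangle C) (hΔ : IsARTriangle Δ)
    (hX : IsSupported T Δ.obj₃) (hτX : IsSupported T Δ.obj₁) :
    (¬ IsInAdd T Δ.obj₃ → ¬ IsInAdd T (Δ.obj₃⟦(-1 : ℤ)⟧) →
      IsARSequence ((homFunctor k T).map Δ.mor₁) ((homFunctor k T).map Δ.mor₂)) ∧
    (¬ Projective ((homFunctor k T).obj Δ.obj₃) → ¬ Injective ((homFunctor k T).obj Δ.obj₁) →
      IsARSequence ((homFunctor k T).map Δ.mor₁) ((homFunctor k T).map Δ.mor₂)) :=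
  ⟨hΔ.isARSequence_map k hX hτX, fun hproj hinj => hΔ.isARSequence_map k hX hτX
    (fun h => hproj (h.projective_homFunctor_obj k))
    (fun h => hinj (hΔ.injective_homFunctor_obj k h))⟩
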